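/- **Lemma (Limits of Gradients).** Let $f:\mathbb{R}^n\to\mathbb{R}$ and $\bar x\in\mathbb{R}^n$. Suppose $f$ is continuous on an open set $\mathcal V$ containing $\bar x$ and differentiable at every point of an open set $\mathcal Q\subset\mathcal V$ of full Lebesgue measure in $\mathcal V$ (i.e. $\mathcal V\setminus\mathcal Q$ is Lebesgue null), and suppose the horizon subdifferential $\partial^\infty f(\bar x)$ is pointed. For $x\in\mathbb{R}^n$ and $\delta>0$ with $x+\delta\mathbb{B}\subset\mathcal V$ put $$G_\delta(x):=\mathrm{cl}\,\mathrm{conv}\,\{\nabla f(y) : y\in (x+\delta\mathbb{B})\cap\mathcal Q\}.$$ Let $x^k\to\bar x$ and $\delta_k\to0$ with $\delta_k>0$ and $x^k+\delta_k\mathbb{B}\subset\mathcal V$ for all $k$. Then: (a) if $w^k\to\bar w$ with $w^k\in G_{\delta_k}(x^k)$ for all $k$, then $\bar w\in\bar\partial f(\bar x)$; (b) if $v^k\to\bar v$ with $v^k\in G_{\delta_k}(x^k)^\infty$ for all $k$, then $\bar v\in\bar\partial^\infty f(\bar x)$. Here $\mathbb{B}$ is the closed Euclidean unit ball, and: - A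 set $K$ is pointed if for all $k\ge2$ and $x^1,\dots,x^k\in K$, $x^1+\dots+x^k=0$ if and only if $x^1=\dots=x^k=0$. - $C^\infty$ is the horizon cone $\{w : \exists\, x^k\in C,\ t_k>0,\ t_k\to0,\ t_kx^k\to w\}$. - $\hat\partial f(x)$ is the set of $v$ with $f(z)\ge f(x)+\langle v,z-x\rangle+o(\|z-x\|)$ as $z\to x$, and $\partial^\infty f(\bar x)$ is the set of limits of $t_ku^k$ with $t_k>0$, $t_k\to0$, $y^k\to\bar x$, $u^k\in\hat\partial f(y^k)$. - For $C\subset\mathbb{R}^{n+1}$ and $p\in C$, $\widehat N_C(p)$ is the set of $v$ with $\langle v,q-p\rangle\le o(\|q-p\|)$ for $q\in C$, $q\to p$; the graph of $N_C$ is the closure of the graph $\{(p,v): p\in C,\ v\in\widehat N_C(p)\}$; and $\bar N_C(p)=\mathrm{cl}\,\mathrm{conv}\,N_C(p)$. - With $\mathrm{epi} f=\{(x,\mu)\in\mathbb{R}^n\times\mathbb{R} : f(x)\le\mu\}$, the Clarke subdifferential is $\bar\partial f(x)=\{v : (v,-1)\in\bar N_{\mathrm{epi} f}(x,f(x))\}$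 and the Clarke horizon subdifferential is $\bar\partial^\infty f(x)=\{v : (v,0)\in\bar N_{\mathrm{epi} f}(x,f(x))\}$. -/

import Mathlib

open Filter Topology MeasureTheory
open scoped InnerProductSpace

namespace VarAnalysis

/-- `K` is pointed: finitely many (at least two) elements of `K` sum to zero
only if they all vanish. -/
def IsPointed {E : Type*} [AddCommGroup E] (K : Set E) : Prop :=
  ∀ k : ℕ, 2 ≤ k → ∀ x : Fin k → E, (∀ i, x i ∈ K) →
    (∑ i, x i = 0 ↔ ∀ i, x i = 0)

/-- The horizon cone `C^∞`: limits of `t_k x^k` with `x^k ∈ C` and `t_k ↓ 0`. -/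
def horizonCone {E : Type*} [NormedAddCommGroup E] [NormedSpace ℝ E] (C : Set E) : Set E :=
  {w | ∃ (x : ℕ → E) (t : ℕ → ℝ), (∀ k, x k ∈ C) ∧ (∀ k, 0 < t k) ∧
    Tendsto t atTop (𝓝 0) ∧ Tendsto (fun k => t k • x k) atTop (𝓝 w)}

section Subdifferentials

variable {E : Type*} [NormedAddCommGroup E] [InnerProductSpace ℝ E]

/-- The regular subdifferential: `f z ≥ f x + ⟪v, z - x⟫ + o(‖z - x‖)`. -/
def regularSubdifferential (f : E → ℝ) (x : E) : Set E :=
  {v | ∀ ε : ℝ, 0 < ε → ∀ᶠ z in 𝓝 x, f x + ⟪v, z - x⟫_ℝ - ε * ‖z - x‖ ≤ f z}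

/-- The horizon subdifferential. -/
def horizonSubdifferential (f : E → ℝ) (x : E) : Set E :=
  {v | ∃ (y : ℕ → E) (t : ℕ → ℝ) (u : ℕ → E),
    Tendsto y atTop (𝓝 x) ∧ (∀ k, 0 < t k) ∧ Tendsto t atTop (𝓝 0) ∧
    (∀ k, u k ∈ regularSubdifferential f (y k)) ∧
    Tendsto (fun k => t k • u k) atTop (𝓝 v)}

/-- The regular normal cone to `C` at `x ∈ C`: `⟪v, y - x⟫ ≤ o(‖y - x‖)` for `y ∈ C`.
It is empty at points outside `C`. -/
def regularNormalCone (C : Set E) (x : E) : Set E :=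
  {v | x ∈ C ∧ ∀ ε : ℝ, 0 < ε → ∀ᶠ y in 𝓝[C] x, ⟪v, y - x⟫_ℝ ≤ ε * ‖y - x‖}

/-- The normal cone mapping, whose graph is the closure of the graph of the regular normal
cone mapping. -/
def normalCone (C : Set E) (x : E) : Set E :=
  {v | (x, v) ∈ closure {p : E × E | p.2 ∈ regularNormalCone C p.1}}

/-- The Clarke normal cone `cl conv N_C(x)`. -/
def clarkeNormalCone (C : Set E) (x : E) : Set E :=
  closure (convexHull ℝ (normalCone C x))

/-- The epigraph of `f`, in `E × ℝ` with its Euclidean (`ℓ²`) product structure. -/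
def epi (f : E → ℝ) : Set (WithLp 2 (E × ℝ)) :=
  {p | f p.fst ≤ p.snd}

/-- The Clarke subdifferential: those `v` with `(v, -1)` in the Clarke normal cone to the
epigraph at `(x, f x)`. -/
def clarkeSubdifferential (f : E → ℝ) (x : E) : Set E :=
  {v | WithLp.toLp 2 (v, (-1 : ℝ)) ∈ clarkeNormalCone (epi f) (WithLp.toLp 2 (x, f x))}

/-- The Clarke horizon subdifferential: those `v` with `(v, 0)` in the Clarke normal cone to
the epigraph at `(x, f x)`. -/
def clarkeHorizonSubdifferential (f : E → ℝ) (x : E) : Set E :=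
  {v | WithLp.toLp 2 (v, (0 : ℝ)) ∈ clarkeNormalCone (epi f) (WithLp.toLp 2 (x, f x))}

/-- `G_δ(x) = cl conv ∇f((x + δ𝔹) ∩ Q)`, with `𝔹` the closed unit ball. -/
def gradientHull [CompleteSpace E] (f : E → ℝ) (Q : Set E) (δ : ℝ) (x : E) : Set E :=
  closure (convexHull ℝ ((fun y => gradient f y) '' (Metric.closedBall x δ ∩ Q)))

end Subdifferentials

end VarAnalysis

/-!
The vectors `(∇f(y), -1)`, `y ∈ Q`, are regular normals to the epigraph of `f` at `(y, f y)`, and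
regular normals form a cone.  By Carathéodory's theorem an element of the convex hull of the
gradients near `x k` is a convex combination of a number of gradients that is independent of `k`,
so `(s • w, -s)`, with `w` in that hull and `0 ≤ s`, is a sum of a fixed number of regular normals.

If these summands stay bounded along a subsequence, a further subsequence of each of them
converges, by continuity of `f`, to a normal at `(xbar, f xbar)`, and the limit of the sums lies in
the convex hull of the normal cone.  Otherwise their norms tend to infinity, and dividing by the
largest one kills the second components and the sum; the limits of the first components are then horizon
subgradients, not all zero, whose sum is zero, which pointedness forbids.  This is
`mem_clarkeNormalCone_of_tendsto_sum`.

The claim on gradients is the case `s = 1`, the one on horizon cones the case `s → 0`: a horizon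
direction of the hull is by definition a limit of `t • w` with `t → 0`, so a diagonal choice gives
`t k • w k → vbar`.
-/

namespace VarAnalysis

section

variable {E : Type*} [NormedAddCommGroup E] [InnerProductSpace ℝ E]

theorem smul_mem_regularNormalCone {C : Set E} {x v : E} (hv : v ∈ regularNormalCone C x)
    {c : ℝ} (hc : 0 ≤ c) : c • v ∈ regularNormalCone C x := by
  refine ⟨hv.1, fun ε hε => ?_⟩
  have hc1 : 0 < c + 1 := by linarith
  filter_upwards [hv.2 (ε / (c + 1)) (div_pos hε hc1)] with y hy
  rw [real_inner_smul_left]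
  calc c * ⟪v, y - x⟫_ℝ ≤ c * (ε / (c + 1) * ‖y - x‖) := mul_le_mul_of_nonneg_left hy hc
    _ ≤ (c + 1) * (ε / (c + 1) * ‖y - x‖) := by gcongr; linarith
    _ = ε * ‖y - x‖ := by field_simp

theorem mem_normalCone_of_tendsto {C : Set E} {x v : E} {y u : ℕ → E}
    (hy : Tendsto y atTop (𝓝 x)) (hu : Tendsto u atTop (𝓝 v))
    (h : ∀ k, u k ∈ regularNormalCone C (y k)) : v ∈ normalCone C x :=
  mem_closure_of_tendsto (hy.prodMk_nhds hu) (Eventually.of_forall h)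

theorem gradient_mem_regularSubdifferential [CompleteSpace E] {f : E → ℝ} {x : E}
    (hf : DifferentiableAt ℝ f x) : gradient f x ∈ regularSubdifferential f x := by
  intro ε hε
  filter_upwards [(hasGradientAt_iff_isLittleO.1 hf.hasGradientAt).def hε] with z hz
  have := (abs_le.1 (Real.norm_eq_abs _ ▸ hz)).1
  linarith

theorem toLp_mem_regularNormalCone_epi {f : E → ℝ} {x v : E}
    (hv : v ∈ regularSubdifferential f x) :
    WithLp.toLp 2 (v, (-1 : ℝ)) ∈ regularNormalCone (epi f) (WithLp.toLp 2 (x, f x)) := by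
  refine ⟨le_refl (f x), fun ε hε => ?_⟩
  have hfst : Tendsto (fun p : WithLp 2 (E × ℝ) => p.fst)
      (𝓝[epi f] (WithLp.toLp 2 (x, f x))) (𝓝 x) := by
    have : Continuous fun p : WithLp 2 (E × ℝ) => p.fst :=
      continuous_fst.comp (WithLp.prod_continuous_ofLp 2 E ℝ)
    exact (this.tendsto (WithLp.toLp 2 (x, f x))).mono_left nhdsWithin_le_nhds
  filter_upwards [hfst.eventually (hv ε hε), self_mem_nhdsWithin] with p hp hpe
  have hpe' : f p.fst ≤ p.snd := hpe
  have hn : ε * ‖p.fst - x‖ ≤ ε * ‖p - WithLp.toLp 2 (x, f x)‖ :=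
    mul_le_mul_of_nonneg_left (WithLp.norm_fst_le E (p - WithLp.toLp 2 (x, f x))) hε.le
  have hi : ⟪WithLp.toLp 2 (v, (-1 : ℝ)), p - WithLp.toLp 2 (x, f x)⟫_ℝ =
      ⟪v, p.fst - x⟫_ℝ - (p.snd - f x) := by
    rw [WithLp.prod_inner_apply]
    change ⟪v, p.fst - x⟫_ℝ + ⟪(-1 : ℝ), p.snd - f x⟫_ℝ = _
    simp [sub_eq_add_neg, add_comm]
  rw [hi]
  linarith

/-- Coefficients in the definition of a horizon subgradient may vanish: zero coefficients can be
perturbed to positive ones without changing the limit. -/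
theorem mem_horizonSubdifferential_of_nonneg {f : E → ℝ} {x v : E} {y u : ℕ → E} {t : ℕ → ℝ}
    (hy : Tendsto y atTop (𝓝 x)) (ht0 : ∀ k, 0 ≤ t k) (ht : Tendsto t atTop (𝓝 0))
    (hu : ∀ k, u k ∈ regularSubdifferential f (y k))
    (htu : Tendsto (fun k => t k • u k) atTop (𝓝 v)) : v ∈ horizonSubdifferential f x := by
  -- The perturbation is small even after multiplication by the possibly unbounded `‖u k‖`.
  let e : ℕ → ℝ := fun k => 1 / ((k : ℝ) + 1) / (1 + ‖u k‖)
  have hk : ∀ k : ℕ, 0 < 1 / ((k : ℝ) + 1) := fun k => Nat.one_div_pos_of_nat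
  have hu1 : ∀ k, 0 < 1 + ‖u k‖ := fun k => by positivity
  have he : ∀ k, 0 < e k := fun k => div_pos (hk k) (hu1 k)
  have he' : ∀ k, e k * (1 + ‖u k‖) = 1 / ((k : ℝ) + 1) := fun k =>
    div_mul_cancel₀ _ (hu1 k).ne'
  have hlim : Tendsto (fun k : ℕ => 1 / ((k : ℝ) + 1)) atTop (𝓝 0) :=
    tendsto_one_div_add_atTop_nhds_zero_nat
  have he0 : Tendsto e atTop (𝓝 0) :=
    squeeze_zero (fun k => (he k).le)
      (fun k => by nlinarith [he' k, mul_nonneg (he k).le (norm_nonneg (u k))]) hlim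
  have heu : Tendsto (fun k => e k • u k) atTop (𝓝 0) :=
    squeeze_zero_norm (fun k => by
      rw [norm_smul, Real.norm_of_nonneg (he k).le]
      linarith [he' k, he k]) hlim
  refine ⟨y, fun k => t k + e k, u, hy, fun k => add_pos_of_nonneg_of_pos (ht0 k) (he k),
    by simpa using ht.add he0, hu, ?_⟩
  simpa [add_smul] using htu.add heu

/-- Limits of sums `∑ i, (a i • u i, -a i)` of a fixed number of regular epigraph normals are
Clarke normals, provided that the horizon subdifferential is pointed; the summands themselves are
not assumed to be bounded. -/
theorem mem_clarkeNormalCone_of_tendsto_sum [FiniteDimensional ℝ E] {f : E → ℝ} {xbar : E}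
    (hpointed : IsPointed (horizonSubdifferential f xbar)) {m : ℕ} (hm : 2 ≤ m)
    {y u : ℕ → Fin m → E} {a : ℕ → Fin m → ℝ} {s : ℝ} {w : E}
    (hy : ∀ i, Tendsto (fun k => y k i) atTop (𝓝 xbar))
    (hfy : ∀ i, Tendsto (fun k => f (y k i)) atTop (𝓝 (f xbar)))
    (hu : ∀ k i, u k i ∈ regularSubdifferential f (y k i))
    (ha0 : ∀ k i, 0 ≤ a k i) (ha : Tendsto (fun k => ∑ i, a k i) atTop (𝓝 s))
    (hau : Tendsto (fun k => ∑ i, a k i • u k i) atTop (𝓝 w)) :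
    WithLp.toLp 2 (w, -s) ∈ clarkeNormalCone (epi f) (WithLp.toLp 2 (xbar, f xbar)) := by
  have hle : ∀ k i, a k i ≤ ∑ j, a k j := fun k i =>
    Finset.single_le_sum (f := a k) (fun j _ => ha0 k j) (Finset.mem_univ i)
  obtain ⟨C, hC⟩ := ha.isBoundedUnder_le.eventually_le
  let A : ℕ → Fin m → E := fun k i => a k i • u k i
  have hnot : ¬ Tendsto (fun k => ‖A k‖) atTop atTop := by
    intro hA
    have hinv : Tendsto (fun k => ‖A k‖⁻¹) atTop (𝓝 0) := tendsto_inv_atTop_zero.comp hA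
    have hsphere : ∃ᶠ k in atTop, ‖A k‖⁻¹ • A k ∈ Metric.sphere (0 : Fin m → E) 1 := by
      refine Eventually.frequently ?_
      filter_upwards [hA.eventually_gt_atTop 0] with k hk
      simp [norm_smul, hk.ne']
    obtain ⟨b, hb, φ, hφ, hlim⟩ :=
      (isCompact_sphere (0 : Fin m → E) 1).isSeqCompact.subseq_of_frequently_in hsphere
    have hbi : ∀ i, Tendsto (fun k => (‖A (φ k)‖⁻¹ * a (φ k) i) • u (φ k) i) atTop (𝓝 (b i)) := by
      intro i
      have := tendsto_pi_nhds.1 hlim i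
      simpa [A, Function.comp_def, mul_smul] using this
    have hbmem : ∀ i, b i ∈ horizonSubdifferential f xbar := by
      intro i
      refine mem_horizonSubdifferential_of_nonneg ((hy i).comp hφ.tendsto_atTop)
        (fun k => mul_nonneg (inv_nonneg.2 (norm_nonneg _)) (ha0 (φ k) i)) ?_
        (fun k => hu (φ k) i) (hbi i)
      have h0 : Tendsto (fun k => ‖A k‖⁻¹ * ∑ j, a k j) atTop (𝓝 0) := by
        simpa using hinv.mul ha
      refine squeeze_zero
        (fun k => mul_nonneg (inv_nonneg.2 (norm_nonneg _)) (ha0 (φ k) i))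
        (fun k => ?_) (h0.comp hφ.tendsto_atTop)
      exact mul_le_mul_of_nonneg_left (hle (φ k) i) (inv_nonneg.2 (norm_nonneg _))
    have hsum : ∑ i, b i = 0 := by
      refine tendsto_nhds_unique (tendsto_finsetSum _ fun i _ => hbi i) ?_
      have h0 : Tendsto (fun k => ‖A k‖⁻¹ • ∑ j, a k j • u k j) atTop (𝓝 0) := by
        simpa using hinv.smul hau
      simpa [Function.comp_def, Finset.smul_sum, mul_smul] using h0.comp hφ.tendsto_atTop
    have hb0 : b = 0 := funext ((hpointed m hm b hbmem).1 hsum)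
    simp [hb0] at hb
  obtain ⟨R, hR⟩ : ∃ R, ∃ᶠ k in atTop, ‖A k‖ ≤ R := by
    by_contra! h
    refine hnot (tendsto_atTop.2 fun R => ?_)
    filter_upwards [h R] with k hk
    exact hk.le
  have hbdd : ∃ᶠ k in atTop, (A k, a k) ∈
      Metric.closedBall (0 : (Fin m → E) × (Fin m → ℝ)) (max R (max C 0)) := by
    refine (hR.and_eventually hC).mono fun k hk => ?_
    rw [mem_closedBall_zero_iff, Prod.norm_def]
    refine max_le_max hk.1 ((pi_norm_le_iff_of_nonneg (le_max_right _ _)).2 fun i => ?_)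
    rw [Real.norm_of_nonneg (ha0 k i)]
    exact ((hle k i).trans hk.2).trans (le_max_left _ _)
  obtain ⟨⟨c, α⟩, -, φ, hφ, hlim⟩ :=
    tendsto_subseq_of_frequently_bounded Metric.isBounded_closedBall hbdd
  have hc : ∀ i, Tendsto (fun k => a (φ k) i • u (φ k) i) atTop (𝓝 (c i)) := fun i =>
    tendsto_pi_nhds.1 ((continuous_fst.tendsto _).comp hlim) i
  have hα : ∀ i, Tendsto (fun k => a (φ k) i) atTop (𝓝 (α i)) := fun i =>
    tendsto_pi_nhds.1 ((continuous_snd.tendsto _).comp hlim) i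
  have hcsum : ∑ i, c i = w :=
    tendsto_nhds_unique (tendsto_finsetSum _ fun i _ => hc i) (hau.comp hφ.tendsto_atTop)
  have hαsum : ∑ i, α i = s :=
    tendsto_nhds_unique (tendsto_finsetSum _ fun i _ => hα i) (ha.comp hφ.tendsto_atTop)
  have hm0 : (m : ℝ) ≠ 0 := by positivity
  -- The factor `m` turns the sum of the limits into an average.
  have hmem : ∀ i, (m : ℝ) • WithLp.toLp 2 (c i, -α i) ∈
      normalCone (epi f) (WithLp.toLp 2 (xbar, f xbar)) := by
    intro i
    refine mem_normalCone_of_tendsto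
      (y := fun k => WithLp.toLp 2 (y (φ k) i, f (y (φ k) i)))
      (u := fun k => (m : ℝ) • (a (φ k) i • WithLp.toLp 2 (u (φ k) i, (-1 : ℝ))))
      (((WithLp.prod_continuous_toLp 2 E ℝ).tendsto _).comp
        (((hy i).prodMk_nhds (hfy i)).comp hφ.tendsto_atTop)) ?_
      (fun k => smul_mem_regularNormalCone (smul_mem_regularNormalCone
        (toLp_mem_regularNormalCone_epi (hu _ i)) (ha0 _ i)) m.cast_nonneg)
    have h := ((WithLp.prod_continuous_toLp 2 E ℝ).tendsto _).comp
      ((hc i).prodMk_nhds (hα i).neg)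
    refine (h.const_smul (m : ℝ)).congr fun k => ?_
    simp [← WithLp.toLp_smul]
  refine subset_closure (mem_convexHull_of_exists_fintype (fun _ : Fin m => (m : ℝ)⁻¹)
    (fun i => (m : ℝ) • WithLp.toLp 2 (c i, -α i)) (fun _ => by positivity)
    (by simp [hm0]) hmem ?_)
  simp only [inv_smul_smul₀ hm0]
  rw [← WithLp.toLp_sum, ← hcsum, ← hαsum]
  congr 1
  ext <;> simp [Prod.fst_sum, Prod.snd_sum]

/-- Carathéodory's theorem with a prescribed number of points, allowing zero weights. -/
theorem exists_fin_sum_eq_of_mem_convexHull_image {F : Type*} [AddCommGroup F] [Module ℝ F]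
    [FiniteDimensional ℝ F] {X : Type*} {g : X → F} {S : Set X} {w : F}
    (hw : w ∈ convexHull ℝ (g '' S)) {m : ℕ} (hm : Module.finrank ℝ F + 1 ≤ m) :
    ∃ (c : Fin m → ℝ) (y : Fin m → X), (∀ i, 0 ≤ c i) ∧ ∑ i, c i = 1 ∧ (∀ i, y i ∈ S) ∧
      ∑ i, c i • g (y i) = w := by
  obtain ⟨ι, _, z, c, hz, hind, hc0, hc1, hcz⟩ := eq_pos_convex_span_of_mem_convexHull hw
  choose y hyS hyz using fun i => hz ⟨i, rfl⟩
  obtain ⟨p, hp⟩ : S.Nonempty := Set.image_nonempty.1 (convexHull_nonempty_iff.1 ⟨w, hw⟩)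
  have hcard : Fintype.card ι ≤ Fintype.card (Fin m) := by
    rw [Fintype.card_fin]
    refine (hind.card_le_finrank_succ.trans ?_).trans hm
    gcongr
    exact Submodule.finrank_le _
  obtain ⟨e⟩ := Function.Embedding.nonempty_of_card_le hcard
  have hext : ∀ i ∉ Set.range e, Function.extend e c 0 i = 0 := fun i hi =>
    Function.extend_apply' _ _ _ hi
  refine ⟨Function.extend e c 0, Function.extend e y fun _ => p, fun i => ?_, ?_, fun i => ?_, ?_⟩
  · by_cases hi : ∃ j, e j = i
    · obtain ⟨j, rfl⟩ := hi
      rw [e.injective.extend_apply]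
      exact (hc0 j).le
    · exact (hext i hi).ge
  · rw [← hc1]
    exact (Fintype.sum_of_injective e e.injective _ _ hext
      fun i => (e.injective.extend_apply _ _ _).symm).symm
  · by_cases hi : ∃ j, e j = i
    · obtain ⟨j, rfl⟩ := hi
      rw [e.injective.extend_apply]
      exact hyS j
    · rw [Function.extend_apply' _ _ _ hi]
      exact hp
  · rw [← hcz]
    refine (Fintype.sum_of_injective e e.injective _ _ (fun i hi => ?_) fun i => ?_).symm
    · rw [hext i hi, zero_smul]
    · rw [e.injective.extend_apply, e.injective.extend_apply, hyz]

/-- The common form of the two limit statements: scaled convex combinations of gradients taken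
ever closer to `xbar` converge to Clarke normals. -/
theorem mem_clarkeNormalCone_of_tendsto_smul [FiniteDimensional ℝ E] {f : E → ℝ} {xbar : E}
    (hpointed : IsPointed (horizonSubdifferential f xbar)) (hf : ContinuousAt f xbar)
    {Q : Set E} (hdiff : ∀ y ∈ Q, DifferentiableAt ℝ f y) {x : ℕ → E} {δ : ℕ → ℝ}
    (hx : Tendsto x atTop (𝓝 xbar)) (hδ : Tendsto δ atTop (𝓝 0))
    {s : ℕ → ℝ} {w : ℕ → E} {sbar : ℝ} {wbar : E} (hs0 : ∀ k, 0 ≤ s k)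
    (hs : Tendsto s atTop (𝓝 sbar))
    (hw : ∀ k, w k ∈ convexHull ℝ ((fun y => gradient f y) '' (Metric.closedBall (x k) (δ k) ∩ Q)))
    (hsw : Tendsto (fun k => s k • w k) atTop (𝓝 wbar)) :
    WithLp.toLp 2 (wbar, -sbar) ∈ clarkeNormalCone (epi f) (WithLp.toLp 2 (xbar, f xbar)) := by
  -- One point more than Carathéodory needs, since pointedness speaks of at least two summands.
  choose c y hc0 hc1 hyS hcy using fun k =>
    exists_fin_sum_eq_of_mem_convexHull_image (hw k) (Nat.le_succ (Module.finrank ℝ E + 1))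
  have hy : ∀ i, Tendsto (fun k => y k i) atTop (𝓝 xbar) := by
    intro i
    refine (tendsto_iff_of_dist ?_).2 hx
    exact squeeze_zero (fun _ => dist_nonneg) (fun k => (hyS k i).1) hδ
  refine mem_clarkeNormalCone_of_tendsto_sum hpointed (m := Module.finrank ℝ E + 1 + 1)
    (by omega) hy (fun i => hf.tendsto.comp (hy i))
    (fun k i => gradient_mem_regularSubdifferential (hdiff _ (hyS k i).2))
    (a := fun k i => s k * c k i) (fun k i => mul_nonneg (hs0 k) (hc0 k i)) ?_ ?_
  · simpa [← Finset.mul_sum, hc1] using hs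
  · simpa [mul_smul, ← Finset.smul_sum, hcy] using hsw

end

end VarAnalysis

theorem mainTheorem7 (n : ℕ) (f : EuclideanSpace ℝ (Fin n) → ℝ)
    (xbar : EuclideanSpace ℝ (Fin n))
    (hpointed : VarAnalysis.IsPointed (VarAnalysis.horizonSubdifferential f xbar))
    (V Q : Set (EuclideanSpace ℝ (Fin n)))
    (hV : IsOpen V) (hxV : xbar ∈ V) (hf : ContinuousOn f V)
    (hQ : IsOpen Q) (hQV : Q ⊆ V) (hQfull : volume (V \ Q) = 0)
    (hdiff : ∀ y ∈ Q, DifferentiableAt ℝ f y)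
    (x : ℕ → EuclideanSpace ℝ (Fin n)) (δ : ℕ → ℝ)
    (hx : Tendsto x atTop (𝓝 xbar))
    (hδpos : ∀ k, 0 < δ k) (hδ : Tendsto δ atTop (𝓝 0))
    (hball : ∀ k, Metric.closedBall (x k) (δ k) ⊆ V) :
    (∀ (w : ℕ → EuclideanSpace ℝ (Fin n)) (wbar : EuclideanSpace ℝ (Fin n)),
      Tendsto w atTop (𝓝 wbar) →
      (∀ k, w k ∈ VarAnalysis.gradientHull f Q (δ k) (x k)) →
      wbar ∈ VarAnalysis.clarkeSubdifferential f xbar) ∧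
    (∀ (v : ℕ → EuclideanSpace ℝ (Fin n)) (vbar : EuclideanSpace ℝ (Fin n)),
      Tendsto v atTop (𝓝 vbar) →
      (∀ k, v k ∈ VarAnalysis.horizonCone (VarAnalysis.gradientHull f Q (δ k) (x k))) →
      vbar ∈ VarAnalysis.clarkeHorizonSubdifferential f xbar) := by
  have hcont : ContinuousAt f xbar := hf.continuousAt (hV.mem_nhds hxV)
  have hlim : Tendsto (fun k : ℕ => 1 / ((k : ℝ) + 1)) atTop (𝓝 0) :=
    tendsto_one_div_add_atTop_nhds_zero_nat
  have hpos : ∀ k : ℕ, 0 < 1 / ((k : ℝ) + 1) := fun k => Nat.one_div_pos_of_nat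
  constructor
  · intro w wbar hw hwG
    choose w' hw' hdist using fun k => Metric.mem_closure_iff.1 (hwG k) _ (hpos k)
    have hw'lim : Tendsto w' atTop (𝓝 wbar) := by
      refine (tendsto_iff_of_dist ?_).1 hw
      exact squeeze_zero (fun _ => dist_nonneg) (fun k => (hdist k).le) hlim
    exact VarAnalysis.mem_clarkeNormalCone_of_tendsto_smul hpointed hcont hdiff hx hδ
      (fun _ => zero_le_one) tendsto_const_nhds hw' (by simpa using hw'lim)
  · intro v vbar hv hvG
    -- Diagonal choice: one late term of each sequence defining the horizon direction `v k`.
    have hdiag : ∀ k : ℕ, ∃ (t : ℝ) (w : EuclideanSpace ℝ (Fin n)), 0 < t ∧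
        t < 1 / ((k : ℝ) + 1) ∧
        w ∈ VarAnalysis.gradientHull f Q (δ k) (x k) ∧ dist (t • w) (v k) < 1 / ((k : ℝ) + 1) := by
      intro k
      obtain ⟨w, t, hwG, ht0, ht, htw⟩ := hvG k
      obtain ⟨j, hj1, hj2⟩ :=
        ((ht.eventually_lt_const (hpos k)).and (Metric.tendsto_nhds.1 htw _ (hpos k))).exists
      exact ⟨t j, w j, ht0 j, hj1, hwG j, hj2⟩
    choose t w ht0 ht1 hwG htw using hdiag
    choose w' hw' hdist using fun k => Metric.mem_closure_iff.1 (hwG k) 1 one_pos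
    have ht : Tendsto t atTop (𝓝 0) :=
      squeeze_zero (fun k => (ht0 k).le) (fun k => (ht1 k).le) hlim
    have h1 : Tendsto (fun k => t k • w k) atTop (𝓝 vbar) := by
      refine (tendsto_iff_of_dist ?_).2 hv
      exact squeeze_zero (fun _ => dist_nonneg) (fun k => (htw k).le) hlim
    have h2 : Tendsto (fun k => t k • w' k) atTop (𝓝 vbar) := by
      refine (tendsto_iff_of_dist (squeeze_zero (fun _ => dist_nonneg) (fun k => ?_) ht)).1 h1
      rw [dist_smul₀, Real.norm_of_nonneg (ht0 k).le]
      exact mul_le_of_le_one_right (ht0 k).le (hdist k).le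
    have := VarAnalysis.mem_clarkeNormalCone_of_tendsto_smul hpointed hcont hdiff hx hδ
      (fun k => (ht0 k).le) ht hw' h2
    rwa [neg_zero] at this
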